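/- Let $k$ be a field. For a natural number $d$, let $k\{x_1,\dots,x_d\}$ be the free associative unital $k$-algebra on $x_1,\dots,x_d$. A $k$-algebra $A$ is called an automaton algebra over $k$ if $A\cong k\{x_1,\dots,x_d\}/I$ for some $d$ and some two-sided ideal $I$ generated by words in $x_1,\dots,x_d$, such that there is a (deterministic) finite state automaton with alphabet $\{x_1,\dots,x_d\}$ that accepts a word $w$ if and only if $w\notin I$. A ring $R$ is prime if $R\neq 0$ and, for $a,b\in R$, $aRb=0$ implies $a=0$ or $b=0$. A ring is left (respectively right) primitive if it has a faithful simple left (respectively right) module, and primitive if it is both left and right primitive. A $k$-algebra $A$ is PI if there are $n$ and a nonzero noncommutative polynomial $p\in k\{x_1,\dots,x_n\}$ with $p(a_1,\dots,a_n)=0$ for all $a_1,\dots,a_n\in A$. Theorem. Let $k$ be a field and let $A$ be a prime automaton algebra over $k$. Then $A$ is primitive or $A$ is PI (possibly both). -/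

import Mathlib

/-- The word `x_{i₁} ⋯ x_{iᵣ}`, as an element of the free algebra `k{x₁, …, x_d}`. -/
noncomputable def wordMonomial (k : Type*) [Field k] {d : ℕ} (w : List (Fin d)) :
    FreeAlgebra k (Fin d) :=
  (w.map (FreeAlgebra.ι k)).prod

/-- A two-sided ideal of `k{x₁, …, x_d}` is monomial if it is generated by a set of words. -/
def IsMonomialIdeal {k : Type*} [Field k] {d : ℕ}
    (I : TwoSidedIdeal (FreeAlgebra k (Fin d))) : Prop :=
  ∃ S : Set (List (Fin d)), I = TwoSidedIdeal.span (wordMonomial k '' S)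

/-- `A` is an automaton algebra over `k`: it is isomorphic, as a `k`-algebra, to a monomial algebra
`k{x₁, …, x_d} / I` such that some finite state automaton with alphabet `{x₁, …, x_d}` accepts
exactly the words that do not lie in `I`. -/
def IsAutomatonAlgebra (k A : Type*) [Field k] [Ring A] [Algebra k A] : Prop :=
  ∃ (d : ℕ) (I : TwoSidedIdeal (FreeAlgebra k (Fin d))),
    IsMonomialIdeal I ∧
    Nonempty (I.ringCon.Quotient ≃ₐ[k] A) ∧
    ∃ (Q : Type) (_ : Finite Q) (Γ : DFA (Fin d) Q),
      ∀ w : List (Fin d), w ∈ Γ.accepts ↔ wordMonomial k w ∉ I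

/-- A ring is prime if it is nonzero and `a R b = 0` only if `a = 0` or `b = 0`. -/
def IsPrimeRing (R : Type*) [Ring R] : Prop :=
  Nontrivial R ∧ ∀ a b : R, (∀ r : R, a * r * b = 0) → a = 0 ∨ b = 0

/-- A ring is left primitive if it has a faithful simple left module. (A simple module is a
quotient of the ring, so the universe of `R` is large enough.) -/
def IsLeftPrimitive.{u} (R : Type u) [Ring R] : Prop :=
  ∃ (M : Type u) (_ : AddCommGroup M) (_ : Module R M), IsSimpleModule R M ∧ FaithfulSMul R M

/-- A ring is right primitive if it has a faithful simple right module, that is, a faithful simple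
left module over the opposite ring. -/
def IsRightPrimitive (R : Type*) [Ring R] : Prop :=
  IsLeftPrimitive Rᵐᵒᵖ

/-- Primitive means both left and right primitive. -/
def IsPrimitiveRing (R : Type*) [Ring R] : Prop :=
  IsLeftPrimitive R ∧ IsRightPrimitive R

/-- The `k`-algebra `A` satisfies a polynomial identity: some nonzero noncommutative polynomial
`p(x₁, …, xₙ)` over `k` vanishes at every point of `Aⁿ`. -/
def IsPI (k A : Type*) [Field k] [Ring A] [Algebra k A] : Prop :=
  ∃ (n : ℕ) (p : FreeAlgebra k (Fin n)), p ≠ 0 ∧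
    ∀ a : Fin n → A, FreeAlgebra.lift k a p = 0

/-! ### Combinatorics of prime languages: stable contexts and suffix codes. -/

section Words

variable {α : Type*}

/-! The nonzero words of `A` form a basis and a factor-closed language `L` in which, by primeness,
any two words can be joined. The automaton enters only through the finiteness of the sets of left
contexts of `L` and of its reversal.

If all words of `L` share a period `p`, each of them occurs in a `p`-periodic word with all factors
in `L`. The resulting representations by `p × p` matrices over `k[X]` jointly separate points, so
`A` satisfies a standard identity (`WordBasis.isPI_of_hasPeriod`).

Otherwise take `c` in `L` with minimal left context. Aperiodicity yields infinitely many words `h n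
++ c` forming a suffix code (`IsPrimeLanguage.exists_suffix_code`). For each `w` in `L` and each
bound `D ≥ |w|`, use one of them as a tag: identify `a w b h c` with `c`, and `a w' b h c` with `0`
for the other `w'` of length at most `D`. The left ideal of these relations does not contain `c`
(`WordBasis.mon_notMem_span`), while every nonzero `f` has a multiple `x f y c` congruent to `c`.
This gives a faithful simple left module (`isLeftPrimitive_of_ideal`); reversing words gives the
right-hand side. -/

theorem List.HasPeriod.mul_left {w : List α} {p : ℕ} (h : w.HasPeriod p) (n : ℕ) :
    w.HasPeriod (n * p) := by
  rw [List.hasPeriod_iff_forall_getElem?_mod] at h ⊢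
  intro i hi
  rw [h i hi, h (i % (n * p)) ((Nat.mod_le _ _).trans_lt hi), Nat.mod_mul_left_mod]

theorem List.HasPeriod.reverse {w : List α} {p : ℕ} (h : w.HasPeriod p) :
    w.reverse.HasPeriod p := by
  rw [List.hasPeriod_iff_getElem?] at h ⊢
  intro i hi
  rw [List.length_reverse] at hi
  rw [List.getElem?_reverse (by omega), List.getElem?_reverse (by omega),
    h (w.length - 1 - (i + p)) (by omega)]
  congr 1
  omega

/-- If `a ++ w` is a suffix of `a ++ w'`, then `a` overlaps itself. -/
theorem List.hasPeriod_of_append_suffix {a w w' : List α} (h : a ++ w <:+ a ++ w') :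
    a.HasPeriod (w'.length - w.length) := by
  obtain ⟨x, hx⟩ := h
  have hl := congrArg List.length hx
  simp only [List.length_append] at hl
  rw [List.hasPeriod_iff_getElem?]
  intro i hi
  have h1 := congrArg (fun l => l[i + (w'.length - w.length)]?) hx
  rw [List.getElem?_append_right (by omega), List.getElem?_append_left (by omega),
    List.getElem?_append_left (by omega)] at h1
  rw [← h1]
  congr 1
  omega

/-- The combinatorial content of primeness for the set of nonzero words of a monomial algebra. -/
structure IsPrimeLanguage (L : Set (List α)) : Prop where
  nil_mem : [] ∈ L
  of_infix : ∀ {u v : List α}, v ∈ L → u <:+: v → u ∈ L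
  connect : ∀ {u v : List α}, u ∈ L → v ∈ L → ∃ r, u ++ r ++ v ∈ L

/-- The set of words that may be put to the left of `c`. -/
def leftContext (L : Set (List α)) (c : List α) : Set (List α) := {u | u ++ c ∈ L}

variable {L : Set (List α)}

theorem IsPrimeLanguage.reverse (hL : IsPrimeLanguage L) :
    IsPrimeLanguage {w : List α | w.reverse ∈ L} where
  nil_mem := by simpa using hL.nil_mem
  of_infix hv h := hL.of_infix hv (List.reverse_infix.mpr h)
  connect hu hv := by
    obtain ⟨r, hr⟩ := hL.connect hv hu
    exact ⟨r.reverse, by simpa using hr⟩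

theorem IsPrimeLanguage.leftContext_append_subset (hL : IsPrimeLanguage L) (c w : List α) :
    leftContext L (c ++ w) ⊆ leftContext L c := fun u hu =>
  hL.of_infix hu ⟨[], w, by simp⟩

/-- Some word of `L` has a left context that does not change under right extension. -/
theorem IsPrimeLanguage.exists_stable_leftContext (hL : IsPrimeLanguage L)
    (hfin : (Set.range (leftContext L)).Finite) :
    ∃ c ∈ L, ∀ w, c ++ w ∈ L → leftContext L (c ++ w) = leftContext L c := by
  -- Right extension can only shrink a left context, so a minimal one among the finitely many is
  -- stable.
  obtain ⟨c, hc, hmin⟩ := Set.Finite.exists_minimalFor' (leftContext L) L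
    (hfin.subset (Set.image_subset_range _ _)) ⟨[], hL.nil_mem⟩
  exact ⟨c, hc, fun w hw => (hL.leftContext_append_subset c w).antisymm
    (hmin hw (hL.leftContext_append_subset c w))⟩

theorem prefix_iterate_append {s c : List α} (h : c <+: s ++ c) (n : ℕ) :
    (s ++ ·)^[n] c <+: (s ++ ·)^[n + 1] c := by
  induction n with
  | zero => simpa using h
  | succ n ih =>
    rw [Function.iterate_succ_apply', Function.iterate_succ_apply' _ (n + 1)]
    exact (List.prefix_append_right_inj s).mpr ih

theorem prefix_iterate_append_self {s c : List α} (h : c <+: s ++ c) (n : ℕ) :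
    c <+: (s ++ ·)^[n] c := by
  induction n with
  | zero => simp
  | succ n ih => exact ih.trans (prefix_iterate_append h n)

theorem suffix_iterate_append (s c : List α) (n : ℕ) : c <:+ (s ++ ·)^[n] c := by
  induction n with
  | zero => simp
  | succ n ih =>
    rw [Function.iterate_succ_apply']
    exact ih.trans (List.suffix_append _ _)

theorem length_iterate_append (s c : List α) (n : ℕ) :
    ((s ++ ·)^[n] c).length = n * s.length + c.length := by
  induction n with
  | zero => simp
  | succ n ih =>
    rw [Function.iterate_succ_apply', List.length_append, ih]
    ring

theorem hasPeriod_iterate_append {s c : List α} (h : c <+: s ++ c) (n : ℕ) :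
    ((s ++ ·)^[n + 1] c).HasPeriod s.length := by
  have hp := prefix_iterate_append h n
  rw [List.HasPeriod]
  have : ((s ++ ·)^[n + 1] c).take s.length = s := by
    rw [Function.iterate_succ_apply']; simp
  rw [this]
  conv_lhs => rw [Function.iterate_succ_apply']
  exact (List.prefix_append_right_inj s).mpr hp

/-- Each `sⁿc` begins with `c`, hence by stability has the left context of `c`, and `s` may be
prepended again. -/
theorem IsPrimeLanguage.iterate_append_mem {c s : List α}
    (hc : c ∈ L) (hstable : ∀ w, c ++ w ∈ L → leftContext L (c ++ w) = leftContext L c)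
    (hs : s ++ c ∈ L) (hcs : c <+: s ++ c) (n : ℕ) : (s ++ ·)^[n] c ∈ L := by
  induction n with
  | zero => simpa
  | succ n ih =>
    obtain ⟨y, hy⟩ := prefix_iterate_append_self hcs n
    have h1 := hstable y (by rwa [hy])
    rw [hy] at h1
    rw [Function.iterate_succ_apply']
    exact (Set.ext_iff.mp h1 s).mpr hs

/-- If `L` is not periodic, there are two return words of `c` none of which is a suffix
of the other. -/
theorem IsPrimeLanguage.exists_incomparable (hL : IsPrimeLanguage L)
    (hper : ∀ p, 0 < p → ∃ w ∈ L, ¬ w.HasPeriod p) {c : List α}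
    (hc : c ∈ L) (hstable : ∀ w, c ++ w ∈ L → leftContext L (c ++ w) = leftContext L c) :
    ∃ s t, s ++ c ∈ L ∧ t ++ c ∈ L ∧ c <+: s ++ c ∧ c <+: t ++ c ∧ ¬ s <:+ t ∧ ¬ t <:+ s := by
  by_contra! H
  -- Failure of period 1 serves only to supply a nonempty word, so that `s` below is nonempty.
  obtain ⟨x, hx, hx1⟩ := hper 1 one_pos
  have hx0 : x ≠ [] := by rintro rfl; simp at hx1
  obtain ⟨r, hr⟩ := hL.connect hc hx
  obtain ⟨r', hr'⟩ := hL.connect hr hc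
  set s := c ++ r ++ x ++ r'
  have hcs : c <+: s ++ c := ⟨r ++ x ++ r' ++ c, by simp [s]⟩
  have hs0 : 0 < s.length := by
    have := List.length_pos_of_ne_nil hx0
    simp only [s, List.length_append]; omega
  obtain ⟨w, hw, hwp⟩ := hper s.length hs0
  apply hwp
  obtain ⟨q, hq⟩ := hL.connect hc hw
  obtain ⟨q', hq'⟩ := hL.connect hq hc
  set t := c ++ q ++ w ++ q'
  have hct : c <+: t ++ c := ⟨q ++ w ++ q' ++ c, by simp [t]⟩
  -- `s ^ n` for large `n` has `t` as a suffix
  obtain ⟨z, hz⟩ : ∃ z, (s ++ ·)^[t.length + 1] c = z ++ c := by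
    obtain ⟨z, hz⟩ := suffix_iterate_append s c (t.length + 1)
    exact ⟨z, hz.symm⟩
  have hzL : z ++ c ∈ L := hz ▸ iterate_append_mem hc hstable hr' hcs _
  have hcz : c <+: z ++ c := hz ▸ prefix_iterate_append_self hcs _
  have hzlen : t.length < z.length := by
    have := congrArg List.length hz
    rw [length_iterate_append, List.length_append (as := z)] at this
    clear_value s t
    nlinarith
  have htz : t <:+ z := by
    by_contra hn
    have := (H t z hq' hzL hct hcz hn).length_le
    omega
  have hz' : (z ++ c).HasPeriod s.length := hz ▸ hasPeriod_iterate_append hcs _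
  have hwt : w <:+: t := ⟨c ++ q, q', by simp [t]⟩
  exact hz'.infix (hwt.trans (htz.isInfix.trans (List.prefix_append z c).isInfix))

/-- If `L` is not periodic, it contains infinitely many words ending in `c`, none of which is a
suffix of another. -/
theorem IsPrimeLanguage.exists_suffix_code (hL : IsPrimeLanguage L)
    (hper : ∀ p, 0 < p → ∃ w ∈ L, ¬ w.HasPeriod p) {c : List α}
    (hc : c ∈ L) (hstable : ∀ w, c ++ w ∈ L → leftContext L (c ++ w) = leftContext L c) :
    ∃ h : ℕ → List α, (∀ n, h n ++ c ∈ L) ∧ (∀ n, h n ≠ []) ∧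
      ∀ m n, h m ++ c <:+ h n ++ c → m = n := by
  obtain ⟨s, t, hs, ht, hcs, hct, hst, hts⟩ := hL.exists_incomparable hper hc hstable
  have hs0 : s ≠ [] := by rintro rfl; exact hst List.nil_suffix
  have ht0 : t ≠ [] := by rintro rfl; exact hts List.nil_suffix
  have hz : ∀ n, ∃ z, z ++ c = (s ++ ·)^[n] c := fun n => suffix_iterate_append s c n
  choose z hz using hz
  refine ⟨fun n => t ++ z n, fun n => ?_, fun n => by simp [ht0], fun m n hmn => ?_⟩
  · obtain ⟨y, hy⟩ := prefix_iterate_append_self hcs n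
    have hmem := iterate_append_mem hc hstable hs hcs n
    have h1 := hstable y (by rwa [hy])
    rw [hy] at h1
    rw [List.append_assoc, hz]
    exact (Set.ext_iff.mp h1 t).mpr ht
  · simp only [List.append_assoc, hz] at hmn
    rcases lt_trichotomy m n with hlt | heq | hgt
    · exfalso
      obtain ⟨k, rfl⟩ := Nat.exists_eq_add_of_lt hlt
      -- Both `s sᵐ c` and `t sᵐ c` end the same word, so one of `s`, `t` would be a suffix of the
      -- other.
      have h1 : s ++ (s ++ ·)^[m] c <:+ t ++ (s ++ ·)^[m + k + 1] c := by
        rw [show m + k + 1 = k + (m + 1) by omega, Function.iterate_add_apply,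
          ← Function.iterate_succ_apply' (s ++ ·) m c]
        exact (suffix_iterate_append s _ k).trans (List.suffix_append _ _)
      rcases List.suffix_or_suffix_of_suffix h1 hmn with h2 | h2
      · exact hst (List.suffix_append_self_iff.mp h2)
      · exact hts (List.suffix_append_self_iff.mp h2)
    · exact heq
    · exfalso
      have h1 := hmn.length_le
      simp only [List.length_append, length_iterate_append] at h1
      have := List.length_pos_of_ne_nil hs0
      nlinarith

end Words

/-! ### Monomial algebras and the faithful simple module. -/

section WordBasis

/-- Presentation of `A` as a monomial algebra: a basis of `A` indexed by the words of `L`, such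
that the product of two words is their concatenation if this lies in `L`, and `0` otherwise. -/
structure WordBasis (k A : Type*) [Field k] [Ring A] [Algebra k A] {α : Type*}
    (L : Set (List α)) where
  mon : List α → A
  mon_nil : mon [] = 1
  mon_append : ∀ u v, mon (u ++ v) = mon u * mon v
  mon_eq_zero : ∀ w, w ∉ L → mon w = 0
  basis : Module.Basis L k A
  basis_apply : ∀ w : L, basis w = mon w

variable {k A : Type*} [Field k] [Ring A] [Algebra k A] {α : Type*} {L : Set (List α)}

namespace WordBasis

variable (B : WordBasis k A L)

theorem mon_ne_zero {w : List α} (hw : w ∈ L) : B.mon w ≠ 0 := by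
  rw [← B.basis_apply ⟨w, hw⟩]
  exact B.basis.ne_zero _

theorem mem_of_mon_ne_zero {w : List α} (h : B.mon w ≠ 0) : w ∈ L :=
  by_contra fun hw => h (B.mon_eq_zero w hw)

theorem sum_repr (x : A) : ((B.basis.repr x).sum fun w r => r • B.mon w) = x := by
  conv_rhs => rw [← B.basis.linearCombination_repr x]
  rw [Finsupp.linearCombination_apply]
  simp only [B.basis_apply]

theorem mul_mul_eq_sum (a x b : A) :
    a * x * b = (B.basis.repr x).sum fun w r => r • (a * B.mon w * b) := by
  conv_lhs => rw [← B.sum_repr x]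
  simp only [Finsupp.sum, Finset.mul_sum, Finset.sum_mul, mul_smul_comm, smul_mul_assoc]

open Classical in
theorem exists_linearMap (P : List α → Prop) :
    ∃ φ : A →ₗ[k] k, ∀ w, φ (B.mon w) = if w ∈ L ∧ P w then 1 else 0 := by
  refine ⟨B.basis.constr k fun w => if P w then 1 else 0, fun w => ?_⟩
  by_cases hw : w ∈ L
  · have := B.basis.constr_basis k (fun w => if P w then (1 : k) else 0) ⟨w, hw⟩
    rw [B.basis_apply] at this
    simp [this, hw]
  · simp [B.mon_eq_zero w hw, hw]

theorem isPrimeLanguage (B : WordBasis k A L) (hA : IsPrimeRing A) : IsPrimeLanguage L where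
  nil_mem := by
    have := hA.1
    exact B.mem_of_mon_ne_zero (by rw [B.mon_nil]; exact one_ne_zero)
  of_infix {u v} hv huv := by
    obtain ⟨x, y, rfl⟩ := huv
    refine B.mem_of_mon_ne_zero fun h => B.mon_ne_zero hv ?_
    rw [B.mon_append, B.mon_append, h, mul_zero, zero_mul]
  connect {u v} hu hv := by
    by_contra! H
    refine (hA.2 (B.mon u) (B.mon v) fun r => ?_).elim (B.mon_ne_zero hu) (B.mon_ne_zero hv)
    rw [B.mul_mul_eq_sum]
    refine Finset.sum_eq_zero fun w _ => ?_
    simp only [← B.mon_append, B.mon_eq_zero _ (H w), smul_zero]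

/-- The presentation of the opposite algebra, with all words reversed. -/
noncomputable def op : WordBasis k Aᵐᵒᵖ {w : List α | w.reverse ∈ L} where
  mon w := MulOpposite.op (B.mon w.reverse)
  mon_nil := by simp [B.mon_nil]
  mon_append u v := by simp [B.mon_append]
  mon_eq_zero w hw := by simp [B.mon_eq_zero w.reverse hw]
  basis := (B.basis.map (MulOpposite.opLinearEquiv k)).reindex
    { toFun := fun w => ⟨w.1.reverse, by simp⟩
      invFun := fun w => ⟨w.1.reverse, w.2⟩
      left_inv := fun w => by simp
      right_inv := fun w => by simp }
  basis_apply w := by simp [B.basis_apply]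

end WordBasis

/-- A left ideal that is comaximal, after multiplication by `c`, with all nonzero two-sided ideals
yields a faithful simple module. -/
theorem isLeftPrimitive_of_ideal (M : Ideal A) (c : A) (hc : c ∉ M)
    (h : ∀ f : A, f ≠ 0 → ∃ a b, a * f * (b * c) - c ∈ M) : IsLeftPrimitive A := by
  -- Passing to `{x | x c ∈ M}` replaces `c` by `1`; any maximal left ideal above it works.
  let K : Ideal A := Submodule.comap (LinearMap.toSpanSingleton A A c) M
  have hK : ∀ x, x ∈ K ↔ x * c ∈ M := fun x => by simp [K]
  obtain ⟨N, hN, hKN⟩ := Ideal.exists_le_maximal K fun h1 =>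
    hc (by simpa using (hK 1).mp (h1 ▸ Submodule.mem_top))
  refine ⟨A ⧸ N, inferInstance, inferInstance, isSimpleModule_iff_isCoatom.mpr hN.out, ⟨?_⟩⟩
  intro x y hxy
  by_contra hne
  obtain ⟨a, b, hab⟩ := h (x - y) (sub_ne_zero.mpr hne)
  have h1 : a * (x - y) * b - 1 ∈ N := hKN ((hK _).mpr (by
    simpa only [sub_mul, one_mul, mul_assoc] using hab))
  have h2 : (x - y) * b ∈ N := by
    have := hxy (Submodule.Quotient.mk b)
    rwa [← Submodule.Quotient.mk_smul, ← Submodule.Quotient.mk_smul, Submodule.Quotient.eq,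
      smul_eq_mul, smul_eq_mul, ← sub_mul] at this
  have h3 : a * (x - y) * b ∈ N := by
    rw [mul_assoc]; exact N.mul_mem_left a h2
  exact hN.ne_top ((Ideal.eq_top_iff_one N).mpr (by simpa using N.sub_mem h3 h1))

/-- The words that reduce to `c` under the rewriting rules `u ++ g i ↦ u ++ c`. -/
inductive ReducesTo {ι : Type*} (g : ι → List α) (c : List α) : List α → Prop
  | refl : ReducesTo g c c
  | step (u : List α) (i : ι) : ReducesTo g c (u ++ c) → ReducesTo g c (u ++ g i)

/-- Words `m i w`, no one a suffix of another, of which `m i (w₁ i)` is identified with `c` and the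
others with `0`, do not make `c` itself vanish. -/
theorem WordBasis.mon_notMem_span (B : WordBasis k A L) {ι : Type*} {W : ι → Set (List α)}
    (w₁ : ι → List α) (m : ι → List α → List α) (c : List α) (hc : c ∈ L)
    (hw₁ : ∀ i, w₁ i ∈ W i) (hlen : ∀ i w, c.length < (m i w).length)
    (hcode : ∀ i j, ∀ w ∈ W i, ∀ w' ∈ W j, m i w <:+ m j w' → i = j ∧ w = w')
    (hctx : ∀ i, leftContext L (m i (w₁ i)) = leftContext L c) :
    B.mon c ∉ (Ideal.span ({x | ∃ i, x = B.mon (m i (w₁ i)) - B.mon c} ∪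
      {x | ∃ i, ∃ w ∈ W i, w ≠ w₁ i ∧ x = B.mon (m i w)}) : Ideal A) := by
  classical
  set R := ReducesTo (fun i => m i (w₁ i)) c
  -- The suffix code makes the last rewriting step unique; the length condition excludes the trivial
  -- reduction.
  have hstep : ∀ u i, ∀ w ∈ W i, R (u ++ m i w) → w = w₁ i ∧ R (u ++ c) := by
    intro u i w hw h
    generalize hx : u ++ m i w = x at h
    cases h with
    | refl =>
      have := congrArg List.length hx
      have := hlen i w
      rw [List.length_append] at *
      omega
    | step u' j h =>
      have h1 : m i w <:+ u' ++ m j (w₁ j) := ⟨u, hx⟩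
      have h2 : i = j ∧ w = w₁ j := by
        rcases List.suffix_or_suffix_of_suffix h1 (List.suffix_append _ _) with h3 | h3
        · exact hcode _ _ _ hw _ (hw₁ j) h3
        · obtain ⟨rfl, rfl⟩ := hcode _ _ _ (hw₁ j) _ hw h3
          exact ⟨rfl, rfl⟩
      obtain ⟨rfl, rfl⟩ := h2
      rw [List.append_cancel_right hx]
      exact ⟨rfl, h⟩
  -- `φ` counts the words of `L` that reduce to `c`. It kills the left ideal but takes the value 1
  -- at `c`.
  obtain ⟨φ, hφ⟩ := B.exists_linearMap R
  have hsum : ∀ y z : A, (∀ u, φ (B.mon u * z) = 0) → φ (y * z) = 0 := by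
    intro y z hz
    have := B.mul_mul_eq_sum 1 y z
    rw [one_mul] at this
    rw [this, Finsupp.sum, map_sum]
    exact Finset.sum_eq_zero fun w _ => by rw [one_mul, map_smul, hz, smul_zero]
  have hzero : ∀ z ∈ (Ideal.span ({x | ∃ i, x = B.mon (m i (w₁ i)) - B.mon c} ∪
      {x | ∃ i, ∃ w ∈ W i, w ≠ w₁ i ∧ x = B.mon (m i w)}) : Ideal A), ∀ y, φ (y * z) = 0 := by
    intro z hz
    induction hz using Submodule.span_induction with
    | mem z hz =>
      intro y
      refine hsum y z fun u => ?_
      rcases hz with ⟨i, rfl⟩ | ⟨i, w, hw, hne, rfl⟩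
      -- Equal left contexts ensure that a rewriting step never enters or leaves `L`.
      · have hL : u ++ m i (w₁ i) ∈ L ↔ u ++ c ∈ L := Set.ext_iff.mp (hctx i) u
        have hR : R (u ++ m i (w₁ i)) ↔ R (u ++ c) :=
          ⟨fun h => (hstep u i _ (hw₁ i) h).2, fun h => ReducesTo.step u i h⟩
        rw [mul_sub, map_sub, ← B.mon_append, ← B.mon_append, hφ, hφ, hL, hR, sub_self]
      · rw [← B.mon_append, hφ, if_neg fun h => hne (hstep u i w hw h.2).1]
    | zero => simp
    | add x z _ _ hx hz => intro y; rw [mul_add, map_add, hx, hz, add_zero]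
    | smul a z _ hz => intro y; rw [smul_eq_mul, ← mul_assoc]; exact hz _
  intro hmem
  have h1 := hzero _ hmem 1
  rw [one_mul, hφ, if_pos ⟨hc, ReducesTo.refl⟩] at h1
  exact one_ne_zero h1

theorem WordBasis.isLeftPrimitive [Countable α] (B : WordBasis k A L) (hL : IsPrimeLanguage L)
    (hfin : (Set.range (leftContext L)).Finite)
    (hper : ∀ p, 0 < p → ∃ w ∈ L, ¬ w.HasPeriod p) : IsLeftPrimitive A := by
  classical
  obtain ⟨c, hc, hstable⟩ := hL.exists_stable_leftContext hfin
  obtain ⟨h, hhL, hh0, hhcode⟩ := hL.exists_suffix_code hper hc hstable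
  obtain ⟨e, he⟩ := exists_injective_nat (L × ℕ)
  -- `a` starts with `c`, to inherit its left context, and has no period up to `D`, to prevent
  -- overlaps with itself at short shifts.
  have hab : ∀ i : L × ℕ, ∃ a b : List α, c <+: a ∧ a ++ i.1 ++ b ++ h (e i) ++ c ∈ L ∧
      ∀ q, 0 < q → q ≤ i.2 → ¬ a.HasPeriod q := by
    rintro ⟨⟨w, hw⟩, D⟩
    -- A period `q ≤ D` of `a` would pass to its factor `v` and to the multiple `D!` of `q`.
    obtain ⟨v, hv, hvp⟩ := hper D.factorial D.factorial_pos
    obtain ⟨r, hr⟩ := hL.connect hc hv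
    obtain ⟨r', hr'⟩ := hL.connect hr hw
    obtain ⟨r'', hr''⟩ := hL.connect hr' (hhL (e (⟨w, hw⟩, D)))
    refine ⟨c ++ r ++ v ++ r', r'', ⟨r ++ v ++ r', by simp⟩, by simpa using hr'', ?_⟩
    intro q hq hqD hp
    obtain ⟨n, hn⟩ := Nat.dvd_factorial hq hqD
    apply hvp
    rw [hn, mul_comm]
    exact (hp.infix ⟨c ++ r, r', by simp⟩).mul_left n
  choose a b hca habL hap using hab
  let ι := {i : L × ℕ // i.1.1.length ≤ i.2}
  let m : ι → List α → List α := fun i w => a i.1 ++ w ++ b i.1 ++ h (e i.1) ++ c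
  let W : ι → Set (List α) := fun i => {w | w.length ≤ i.1.2}
  have hcode : ∀ i j, ∀ w ∈ W i, ∀ w' ∈ W j, m i w <:+ m j w' → i = j ∧ w = w' := by
    intro i j w hw w' hw' hs
    have h1 : h (e i.1) ++ c <:+ m j w' :=
      List.IsSuffix.trans ⟨a i.1 ++ w ++ b i.1, by simp [m]⟩ hs
    have h2 : h (e j.1) ++ c <:+ m j w' := ⟨a j.1 ++ w' ++ b j.1, by simp [m]⟩
    -- The tag `h (e i) ++ c` at the end of the word determines `i`.
    have hij : i = j := by
      apply Subtype.ext
      apply he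
      rcases List.suffix_or_suffix_of_suffix h1 h2 with h3 | h3
      · exact hhcode _ _ h3
      · exact (hhcode _ _ h3).symm
    subst hij
    refine ⟨rfl, ?_⟩
    simp only [m, List.suffix_append_self_iff] at hs
    -- Different lengths of `w` and `w'` would give `a` a period at most `D`.
    have hq := List.hasPeriod_of_append_suffix hs
    have hle := hs.length_le
    simp only [List.length_append] at hle
    by_cases hq0 : w'.length - w.length = 0
    · exact List.append_cancel_left (hs.eq_of_length (by simp only [List.length_append]; omega))
    · refine absurd hq (hap i.1 _ (by omega) ?_)
      have : w'.length ≤ i.1.2 := hw'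
      omega
  have hmem := B.mon_notMem_span (W := W) (fun i => i.1.1.1) m c hc (fun i => i.2) ?_ hcode ?_
  · refine isLeftPrimitive_of_ideal _ (B.mon c) hmem fun f hf => ?_
    obtain ⟨w, hw⟩ : ∃ w, B.basis.repr f w ≠ 0 := by
      by_contra! H
      exact hf (by rw [← B.basis.repr.map_eq_zero_iff]; exact Finsupp.ext H)
    set D := (B.basis.repr f).support.sup fun w => w.1.length
    have hwD : ∀ v ∈ (B.basis.repr f).support, v.1.length ≤ D := fun v hv =>
      Finset.le_sup (f := fun w : L => w.1.length) hv
    have hws := Finsupp.mem_support_iff.mpr hw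
    -- With `D` bounding all words of `f`, every term other than that of `w` falls into the ideal.
    let i : ι := ⟨(w, D), hwD w hws⟩
    refine ⟨(B.basis.repr f w)⁻¹ • B.mon (a i.1), B.mon (b i.1 ++ h (e i.1)), ?_⟩
    rw [smul_mul_assoc, smul_mul_assoc, B.mul_mul_eq_sum, Finsupp.sum,
      ← Finset.add_sum_erase _ _ hws, smul_add, smul_smul, inv_mul_cancel₀ hw, one_smul,
      add_sub_right_comm]
    have hm : ∀ v, B.mon (a i.1) * B.mon v * (B.mon (b i.1 ++ h (e i.1)) * B.mon c) =
        B.mon (m i v) := fun v => by simp only [← B.mon_append, m, List.append_assoc]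
    simp only [hm]
    refine Ideal.add_mem _ (Ideal.subset_span (Or.inl ⟨i, rfl⟩)) ?_
    rw [Finset.smul_sum]
    refine Ideal.sum_mem _ fun v hv => ?_
    rw [Finset.mem_erase] at hv
    rw [smul_smul, ← one_mul (B.mon (m i v)), ← smul_mul_assoc]
    exact Ideal.mul_mem_left _ _ (Ideal.subset_span (Or.inr ⟨i, v, hwD v hv.2,
      fun hvw => hv.1 (Subtype.ext hvw), rfl⟩))
  · intro i w
    have := List.length_pos_of_ne_nil (hh0 (e i.1))
    simp only [m, List.length_append]
    omega
  · intro i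
    obtain ⟨y, hy⟩ := hca i.1
    have h1 : m i i.1.1.1 = c ++ (y ++ i.1.1.1 ++ b i.1 ++ h (e i.1) ++ c) := by
      simp only [m, ← hy, List.append_assoc]
    have h2 : m i i.1.1.1 ∈ L := habL i.1
    rw [h1] at h2 ⊢
    exact hstable _ h2

end WordBasis

/-! ### The standard identity. -/

section StandardPolynomial

open Equiv

/-- The standard polynomial evaluated at `a`. -/
def standardPolynomial {R : Type*} [Ring R] (n : ℕ) (a : Fin n → R) : R :=
  ∑ σ : Perm (Fin n), Perm.sign σ • (List.ofFn fun i => a (σ i)).prod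

theorem map_standardPolynomial {R S : Type*} [Ring R] [Ring S] (f : R →+* S) (n : ℕ)
    (a : Fin n → R) : f (standardPolynomial n a) = standardPolynomial n fun i => f (a i) := by
  simp only [standardPolynomial, map_sum, Units.smul_def, map_zsmul, map_list_prod,
    List.map_ofFn]
  rfl

/-- The standard polynomial is alternating and multilinear, so it vanishes on linearly dependent
families. -/
theorem standardPolynomial_eq_zero {K R : Type*} [CommRing K] [IsDomain K] [Ring R] [Algebra K R]
    [Module.Finite K R] [Module.IsTorsionFree K R] {n : ℕ} (hn : Module.finrank K R < n)
    (a : Fin n → R) : standardPolynomial n a = 0 := by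
  have h : ¬ LinearIndependent K a := fun h => by
    have := h.fintype_card_le_finrank
    rw [Fintype.card_fin] at this
    omega
  have := (MultilinearMap.alternatization
    (MultilinearMap.mkPiAlgebraFin K n R)).map_linearDependent a h
  rw [MultilinearMap.alternatization_apply] at this
  exact this

theorem FreeAlgebra.basisFreeMonoid_apply (k X : Type*) [Field k] (w : List X) :
    FreeAlgebra.basisFreeMonoid k X (FreeMonoid.ofList w) = (w.map (FreeAlgebra.ι k)).prod := by
  change FreeAlgebra.equivMonoidAlgebraFreeMonoid.symm (MonoidAlgebra.single _ 1) = _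
  change MonoidAlgebra.lift k _ _ _ (MonoidAlgebra.single _ 1) = _
  rw [MonoidAlgebra.lift_single, one_smul, FreeMonoid.lift_apply]
  rfl

theorem standardPolynomial_ι_ne_zero (k : Type*) [Field k] (n : ℕ) :
    standardPolynomial n (FreeAlgebra.ι k : Fin n → FreeAlgebra k (Fin n)) ≠ 0 := by
  classical
  set b := FreeAlgebra.basisFreeMonoid k (Fin n)
  set w : Perm (Fin n) → FreeMonoid (Fin n) := fun σ => FreeMonoid.ofList (List.ofFn σ)
  have hw_inj : Function.Injective w := fun σ τ h =>
    Equiv.coe_fn_injective (List.ofFn_injective (FreeMonoid.ofList.injective h))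
  have h1 : standardPolynomial n (FreeAlgebra.ι k : Fin n → FreeAlgebra k (Fin n)) =
      ∑ σ : Perm (Fin n), Perm.sign σ • b (w σ) := by
    refine Finset.sum_congr rfl fun σ _ => ?_
    rw [FreeAlgebra.basisFreeMonoid_apply, List.map_ofFn]
    rfl
  intro h
  rw [h1] at h
  have h2 := congrArg (fun x => b.repr x (w 1)) h
  simp only [map_sum, Units.smul_def, map_zsmul, Module.Basis.repr_self, Finsupp.finsetSum_apply,
    Finsupp.smul_apply, map_zero, Finsupp.zero_apply] at h2
  rw [Finset.sum_eq_single 1] at h2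
  · simp at h2
  · intro σ _ hσ
    rw [Finsupp.single_eq_of_ne' (hw_inj.ne hσ), smul_zero]
  · simp

theorem isPI_of_standardPolynomial {k A : Type*} [Field k] [Ring A] [Algebra k A] (n : ℕ)
    (h : ∀ a : Fin n → A, standardPolynomial n a = 0) : IsPI k A := by
  refine ⟨n, standardPolynomial n (FreeAlgebra.ι k), standardPolynomial_ι_ne_zero k n,
    fun a => ?_⟩
  have := map_standardPolynomial (FreeAlgebra.lift k a : FreeAlgebra k (Fin n) →+* A) n
    (FreeAlgebra.ι k)
  simp only [RingHom.coe_coe, FreeAlgebra.lift_ι_apply, h] at this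
  exact this

end StandardPolynomial

/-! ### The periodic case: matrix representations. -/

section PeriodicWords

variable {α : Type*} {p : ℕ}

/-- The word `w` occurs at position `j` in the periodic word `s`. -/
def OccursAt (s : ZMod p → α) : ZMod p → List α → Prop
  | _, [] => True
  | j, x :: w => s j = x ∧ OccursAt s (j + 1) w

theorem occursAt_append (s : ZMod p → α) (j : ZMod p) (u v : List α) :
    OccursAt s j (u ++ v) ↔ OccursAt s j u ∧ OccursAt s (j + u.length) v := by
  induction u generalizing j with
  | nil => simp [OccursAt]
  | cons x u ih =>
    simp only [List.cons_append, OccursAt, ih, List.length_cons, Nat.cast_add, Nat.cast_one,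
      and_assoc, add_assoc, add_comm (1 : ZMod p)]

theorem occursAt_iff_getElem? (s : ZMod p → α) (j : ZMod p) (w : List α) :
    OccursAt s j w ↔ ∀ i < w.length, w[i]? = some (s (j + i)) := by
  induction w generalizing j with
  | nil => simp [OccursAt]
  | cons x w ih =>
    rw [OccursAt, ih, List.length_cons, Nat.forall_lt_succ_left]
    simp only [List.getElem?_cons_zero, List.getElem?_cons_succ, Nat.cast_zero, add_zero,
      Nat.cast_add, Nat.cast_one, Option.some.injEq, eq_comm (a := x), add_assoc,
      add_comm (1 : ZMod p)]

theorem OccursAt.eq {s : ZMod p → α} {j : ZMod p} {u v : List α} (hu : OccursAt s j u)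
    (hv : OccursAt s j v) (h : u.length = v.length) : u = v := by
  rw [occursAt_iff_getElem?] at hu hv
  refine List.ext_getElem? fun i => ?_
  by_cases hi : i < u.length
  · rw [hu i hi, hv i (h ▸ hi)]
  · rw [List.getElem?_eq_none (by omega), List.getElem?_eq_none (by omega)]

variable {L : Set (List α)}

theorem IsPrimeLanguage.exists_long_extension (hL : IsPrimeLanguage L) {x : List α} (hx : x ∈ L)
    (hx0 : x ≠ []) {w : List α} (hw : w ∈ L) (n : ℕ) : ∃ v ∈ L, w <+: v ∧ n ≤ v.length := by
  induction n with
  | zero => exact ⟨w, hw, List.prefix_rfl, Nat.zero_le _⟩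
  | succ n ih =>
    obtain ⟨v, hv, hwv, hn⟩ := ih
    obtain ⟨r, hr⟩ := hL.connect hv hx
    refine ⟨_, hr, hwv.trans ⟨r ++ x, by simp⟩, ?_⟩
    have := List.length_pos_of_ne_nil hx0
    simp only [List.length_append]
    omega

/-- In a periodic prime language, every word occurs in an infinite periodic word all of whose
factors are in the language. -/
theorem IsPrimeLanguage.exists_occursAt [NeZero p] (hL : IsPrimeLanguage L) {x : List α}
    (hx : x ∈ L) (hx0 : x ≠ []) (hper : ∀ w ∈ L, w.HasPeriod p) {w : List α} (hw : w ∈ L) :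
    ∃ s : ZMod p → α, OccursAt s 0 w ∧ ∀ j u, OccursAt s j u → u ∈ L := by
  obtain ⟨v, hv, hwv, hp⟩ := hL.exists_long_extension hx hx0 hw p
  let s : ZMod p → α := fun j => v[j.val]'((ZMod.val_lt j).trans_le hp)
  -- The first `p` letters of `v` determine every extension of `v` in `L`, by periodicity.
  have key : ∀ v', v' ∈ L → v <+: v' → OccursAt s 0 v' := by
    intro v' hv' hvv'
    rw [occursAt_iff_getElem?]
    intro i hi
    have hip := (Nat.mod_lt i (NeZero.pos p)).trans_le hp
    rw [List.hasPeriod_iff_forall_getElem?_mod.mp (hper v' hv') i hi,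
      ← List.prefix_iff_getElem?.mp hvv' _ hip |>.symm]
    simp [s, ZMod.val_natCast]
  refine ⟨s, ?_, fun j u hu => ?_⟩
  · obtain ⟨y, hy⟩ := hwv
    have := key v hv List.prefix_rfl
    rw [← hy, occursAt_append] at this
    exact this.1
  · obtain ⟨v', hv', hvv', hlen⟩ := hL.exists_long_extension hx hx0 hv (j.val + u.length)
    have h1 := key v' hv' hvv'
    rw [← List.take_append_drop j.val v', occursAt_append,
      ← List.take_append_drop u.length (v'.drop j.val), occursAt_append, List.length_take,
      min_eq_left (by omega), zero_add, ZMod.natCast_val, ZMod.cast_id'] at h1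
    rw [hu.eq h1.2.1 (by simp; omega)]
    exact hL.of_infix hv' ((List.take_prefix _ _).isInfix.trans (List.drop_suffix _ _).isInfix)

variable {k A : Type*} [Field k] [Ring A] [Algebra k A]

open Polynomial

open Classical in
/-- The matrix by which the word `w` acts on the positions of the periodic word `s`. -/
noncomputable def occurrenceMatrix (k : Type*) [Field k] (s : ZMod p → α) (w : List α) :
    Matrix (ZMod p) (ZMod p) k[X] :=
  Matrix.of fun i j => if OccursAt s i w ∧ j = i + w.length then X ^ w.length else 0

open Classical in
theorem occurrenceMatrix_apply (s : ZMod p → α) (w : List α) (i j : ZMod p) :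
    occurrenceMatrix k s w i j =
      if OccursAt s i w ∧ j = i + w.length then X ^ w.length else 0 := rfl

theorem occurrenceMatrix_append [NeZero p] (s : ZMod p → α) (u v : List α) :
    occurrenceMatrix k s (u ++ v) = occurrenceMatrix k s u * occurrenceMatrix k s v := by
  classical
  ext1 i j
  rw [Matrix.mul_apply, Finset.sum_eq_single (i + (u.length : ZMod p))]
  · have h : (OccursAt s i (u ++ v) ∧ j = i + ((u ++ v).length : ZMod p)) ↔
        OccursAt s i u ∧ OccursAt s (i + u.length) v ∧ j = i + u.length + v.length := by
      rw [occursAt_append, List.length_append, Nat.cast_add, add_assoc, and_assoc]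
    simp only [occurrenceMatrix_apply, h, and_true]
    by_cases h1 : OccursAt s i u <;>
      by_cases h2 : OccursAt s (i + u.length) v ∧ j = i + u.length + v.length <;>
      simp only [h1, h2, if_true, if_false, true_and, false_and, and_self, mul_zero, zero_mul,
        List.length_append, pow_add]
  · intro l _ hl
    rw [occurrenceMatrix_apply, if_neg fun h => hl h.2, zero_mul]
  · simp

theorem WordBasis.exists_algHom_matrix [NeZero p] (B : WordBasis k A L)
    (s : ZMod p → α) (hs : ∀ j u, OccursAt s j u → u ∈ L) :
    ∃ ρ : A →ₐ[k] Matrix (ZMod p) (ZMod p) k[X], ∀ w, ρ (B.mon w) = occurrenceMatrix k s w := by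
  let ρ := B.basis.constr k fun w => occurrenceMatrix k s w
  have hρ : ∀ w, ρ (B.mon w) = occurrenceMatrix k s w := by
    intro w
    by_cases hw : w ∈ L
    · rw [← B.basis_apply ⟨w, hw⟩]
      exact B.basis.constr_basis k _ _
    · rw [B.mon_eq_zero w hw, map_zero]
      ext1 i j
      have : ¬ OccursAt s i w := fun h => hw (hs i w h)
      simp [occurrenceMatrix, this]
  refine ⟨AlgHom.ofLinearMap ρ ?_ ?_, hρ⟩
  · rw [← B.mon_nil, hρ]
    ext1 i j
    simp [occurrenceMatrix, OccursAt, Matrix.one_apply, eq_comm]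
  · intro x y
    have : (LinearMap.mul k A).compr₂ ρ = (LinearMap.mul k _).compl₁₂ ρ ρ := by
      refine B.basis.ext fun u => B.basis.ext fun v => ?_
      simp only [LinearMap.compr₂_apply, LinearMap.compl₁₂_apply, LinearMap.mul_apply',
        B.basis_apply, ← B.mon_append, hρ, occurrenceMatrix_append]
    exact LinearMap.congr_fun₂ this x y

theorem WordBasis.isPI_of_hasPeriod (B : WordBasis k A L) (hL : IsPrimeLanguage L)
    (hp : 0 < p) (hper : ∀ w ∈ L, w.HasPeriod p) : IsPI k A := by
  have : NeZero p := ⟨hp.ne'⟩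
  by_cases hx : ∃ x ∈ L, x ≠ []
  · obtain ⟨x, hx, hx0⟩ := hx
    refine isPI_of_standardPolynomial
      (Module.finrank k[X] (Matrix (ZMod p) (ZMod p) k[X]) + 1) fun a => ?_
    refine B.basis.ext_elem fun ⟨w, hw⟩ => ?_
    obtain ⟨s, hsw, hs⟩ := hL.exists_occursAt hx hx0 hper hw
    obtain ⟨ρ, hρ⟩ := B.exists_algHom_matrix s hs
    -- The exponent of `X` records the length that positions modulo `p` forget, so this coefficient
    -- isolates `w` among all words.
    let ψ : A →ₗ[k] k := Polynomial.lcoeff k w.length ∘ₗ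
      (Matrix.entryLinearMap k k[X] (0 : ZMod p) (w.length : ZMod p)) ∘ₗ ρ.toLinearMap
    have hψ : ψ = B.basis.coord ⟨w, hw⟩ := by
      classical
      refine B.basis.ext fun v => ?_
      have h1 : ψ (B.basis v) = (occurrenceMatrix k s v.1 0 (w.length : ZMod p)).coeff w.length := by
        rw [B.basis_apply, ← hρ]
        rfl
      rw [h1, Module.Basis.coord_apply, Module.Basis.repr_self, occurrenceMatrix_apply]
      by_cases hv : v = ⟨w, hw⟩
      · subst hv
        rw [if_pos ⟨hsw, by rw [zero_add]⟩, Finsupp.single_eq_same, coeff_X_pow_self]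
      · rw [Finsupp.single_eq_of_ne' hv]
        split_ifs with h
        · rw [coeff_X_pow, if_neg fun h2 => hv (Subtype.ext (h.1.eq hsw h2.symm))]
        · rw [coeff_zero]
    have h0 : ρ (standardPolynomial _ a) = 0 :=
      (map_standardPolynomial (ρ : A →+* Matrix (ZMod p) (ZMod p) k[X]) _ a).trans
        (standardPolynomial_eq_zero (K := k[X]) (Nat.lt_succ_self _) _)
    rw [← B.basis.coord_apply, ← hψ, map_zero, Finsupp.zero_apply]
    simp [ψ, h0]
  · push Not at hx
    have : Finite L := Set.Finite.subset (Set.finite_singleton []) hx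
    have : Module.Finite k A := Module.Finite.of_basis B.basis
    exact isPI_of_standardPolynomial (Module.finrank k A + 1)
      (standardPolynomial_eq_zero (K := k) (Nat.lt_succ_self _))

end PeriodicWords

/-! ### From the automaton presentation to a word basis. -/

section Automaton

variable {k A : Type*} [Field k] [Ring A] [Algebra k A] {d : ℕ}

theorem wordMonomial_append (u v : List (Fin d)) :
    wordMonomial k (u ++ v) = wordMonomial k u * wordMonomial k v := by
  simp [wordMonomial]

theorem span_range_wordMonomial :
    Submodule.span k (Set.range (wordMonomial k : List (Fin d) → _)) = ⊤ := by
  rw [← (FreeAlgebra.basisFreeMonoid k (Fin d)).span_eq]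
  congr 2
  ext1 w
  exact (FreeAlgebra.basisFreeMonoid_apply k (Fin d) w).symm

open Classical in
theorem coord_wordMonomial (w v : List (Fin d)) :
    (FreeAlgebra.basisFreeMonoid k (Fin d)).coord (FreeMonoid.ofList w) (wordMonomial k v) =
      if v = w then 1 else 0 := by
  rw [wordMonomial, ← FreeAlgebra.basisFreeMonoid_apply, Module.Basis.coord_apply,
    Module.Basis.repr_self, Finsupp.single_apply]
  exact if_congr FreeMonoid.ofList.apply_eq_iff_eq rfl rfl

/-- Every word in the support of an element of a monomial ideal lies in the ideal. -/
theorem IsMonomialIdeal.coord_eq_zero {I : TwoSidedIdeal (FreeAlgebra k (Fin d))}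
    (hI : IsMonomialIdeal I) {f : FreeAlgebra k (Fin d)} (hf : f ∈ I) {w : List (Fin d)}
    (hw : wordMonomial k w ∉ I) :
    (FreeAlgebra.basisFreeMonoid k (Fin d)).coord (FreeMonoid.ofList w) f = 0 := by
  classical
  obtain ⟨S, rfl⟩ := hI
  rw [TwoSidedIdeal.mem_span_iff_mem_addSubgroup_closure] at hf
  induction hf using AddSubgroup.closure_induction with
  | mem f hf =>
    obtain ⟨_, ⟨x, -, _, ⟨v, hv, rfl⟩, rfl⟩, y, -, rfl⟩ := hf
    have hx : x ∈ Submodule.span k (Set.range (wordMonomial k)) :=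
      span_range_wordMonomial (k := k) (d := d) ▸ Submodule.mem_top
    have hy : y ∈ Submodule.span k (Set.range (wordMonomial k)) :=
      span_range_wordMonomial (k := k) (d := d) ▸ Submodule.mem_top
    simp only
    induction hx using Submodule.span_induction with
    | mem x hx =>
      obtain ⟨u, rfl⟩ := hx
      induction hy using Submodule.span_induction with
      | mem y hy =>
        obtain ⟨z, rfl⟩ := hy
        rw [← wordMonomial_append, ← wordMonomial_append, coord_wordMonomial, if_neg]
        rintro rfl
        apply hw
        rw [wordMonomial_append, wordMonomial_append]
        exact TwoSidedIdeal.mul_mem_right _ _ _ (TwoSidedIdeal.mul_mem_left _ _ _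
          (TwoSidedIdeal.subset_span ⟨v, hv, rfl⟩))
      | zero => simp
      | add y z _ _ hy hz => rw [mul_add, map_add, hy, hz, add_zero]
      | smul c y _ hy => rw [mul_smul_comm, map_smul, hy, smul_zero]
    | zero => simp
    | add y z _ _ hy hz => rw [add_mul, add_mul, map_add, hy, hz, add_zero]
    | smul c y _ hy => rw [smul_mul_assoc, smul_mul_assoc, map_smul, hy, smul_zero]
  | zero => simp
  | add f g _ _ hf hg => rw [map_add, hf, hg, add_zero]
  | neg f _ hf => rw [map_neg, hf, neg_zero]

theorem IsMonomialIdeal.nonempty_wordBasis {I : TwoSidedIdeal (FreeAlgebra k (Fin d))}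
    (hI : IsMonomialIdeal I) (e : I.ringCon.Quotient ≃ₐ[k] A) :
    Nonempty (WordBasis k A {w : List (Fin d) | wordMonomial k w ∉ I}) := by
  classical
  let π : FreeAlgebra k (Fin d) →ₐ[k] A := (e : I.ringCon.Quotient →ₐ[k] A).comp (I.ringCon.mkₐ k)
  have hπ : ∀ x, π x = 0 ↔ x ∈ I := by
    intro x
    have h1 : π x = e (x : I.ringCon.Quotient) := rfl
    rw [h1, EmbeddingLike.map_eq_zero_iff, TwoSidedIdeal.mem_iff, ← RingCon.coe_zero,
      RingCon.eq]
  have hsurj : Function.Surjective π := e.surjective.comp Quotient.mk_surjective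
  set L := {w : List (Fin d) | wordMonomial k w ∉ I}
  have hli : LinearIndependent k fun w : L => π (wordMonomial k w.1) := by
    rw [linearIndependent_iff']
    intro s g hg i hi
    simp only [← map_smul, ← map_sum, hπ] at hg
    have h1 := hI.coord_eq_zero hg i.2
    simp only [map_sum, map_smul, coord_wordMonomial, smul_eq_mul, mul_ite, mul_one,
      mul_zero] at h1
    rw [Finset.sum_eq_single i] at h1
    · simpa using h1
    · intro j _ hj
      rw [if_neg fun h => hj (Subtype.ext h)]
    · exact fun h => absurd hi h
  have hsp : ⊤ ≤ Submodule.span k (Set.range fun w : L => π (wordMonomial k w.1)) := by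
    intro x _
    obtain ⟨x, rfl⟩ := hsurj x
    have hx : x ∈ Submodule.span k (Set.range (wordMonomial k)) :=
      span_range_wordMonomial (k := k) (d := d) ▸ Submodule.mem_top
    induction hx using Submodule.span_induction with
    | mem x hx =>
      obtain ⟨w, rfl⟩ := hx
      by_cases hw : wordMonomial k w ∈ I
      · rw [(hπ _).mpr hw]
        exact Submodule.zero_mem _
      · exact Submodule.subset_span ⟨⟨w, hw⟩, rfl⟩
    | zero => simp
    | add y z _ _ hy hz => rw [map_add]; exact Submodule.add_mem _ (hy trivial) (hz trivial)
    | smul c y _ hy => rw [map_smul]; exact Submodule.smul_mem _ _ (hy trivial)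
  exact ⟨{
    mon := fun w => π (wordMonomial k w)
    mon_nil := by simp [wordMonomial]
    mon_append := fun u v => by rw [wordMonomial_append, map_mul]
    mon_eq_zero := fun w hw => (hπ _).mpr (not_not.mp hw)
    basis := Module.Basis.mk hli hsp
    basis_apply := fun w => Module.Basis.mk_apply hli hsp w }⟩

theorem DFA.finite_range_leftContext {α Q : Type*} [Finite Q] (Γ : DFA α Q) :
    (Set.range (leftContext (Γ.accepts : Set (List α)))).Finite := by
  have : Set.range (leftContext (Γ.accepts : Set (List α))) ⊆
      Set.range fun T : Set Q => {u : List α | Γ.eval u ∈ T} := by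
    rintro _ ⟨c, rfl⟩
    -- A left context depends only on the set of states from which `c` is accepted.
    refine ⟨{q | Γ.evalFrom q c ∈ Γ.accept}, ?_⟩
    ext u
    change _ ↔ Γ.evalFrom Γ.start (u ++ c) ∈ Γ.accept
    rw [DFA.evalFrom_of_append]
    rfl
  exact (Set.finite_range _).subset this

theorem DFA.finite_range_leftContext_reverse {α Q : Type*} [Finite Q] (Γ : DFA α Q) :
    (Set.range (leftContext {w : List α | w.reverse ∈ (Γ.accepts : Set (List α))})).Finite := by
  have : Set.range (leftContext {w : List α | w.reverse ∈ (Γ.accepts : Set (List α))}) ⊆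
      Set.range fun q : Q => {u : List α | Γ.evalFrom q u.reverse ∈ Γ.accept} := by
    rintro _ ⟨c, rfl⟩
    -- After reversal `c` is read first, so a single state suffices.
    refine ⟨Γ.eval c.reverse, ?_⟩
    ext u
    change _ ↔ Γ.evalFrom Γ.start (u ++ c).reverse ∈ Γ.accept
    rw [List.reverse_append, DFA.evalFrom_of_append]
    rfl
  exact (Set.finite_range _).subset this

end Automaton

theorem theorem4p1 (k A : Type*) [Field k] [Ring A] [Algebra k A]
    (hA : IsAutomatonAlgebra k A) (hprime : IsPrimeRing A) :
    IsPrimitiveRing A ∨ IsPI k A := by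
  obtain ⟨d, I, hI, ⟨e⟩, Q, _, Γ, hΓ⟩ := hA
  obtain ⟨B⟩ := hI.nonempty_wordBasis e
  have hL := B.isPrimeLanguage hprime
  have hacc : {w : List (Fin d) | wordMonomial k w ∉ I} = (Γ.accepts : Set (List (Fin d))) :=
    Set.ext fun w => (hΓ w).symm
  rw [hacc] at B hL
  by_cases hper : ∃ p, 0 < p ∧ ∀ w ∈ (Γ.accepts : Set (List (Fin d))), w.HasPeriod p
  · obtain ⟨p, hp, hper⟩ := hper
    exact Or.inr (B.isPI_of_hasPeriod hL hp hper)
  · push Not at hper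
    refine Or.inl ⟨B.isLeftPrimitive hL Γ.finite_range_leftContext hper,
      B.op.isLeftPrimitive hL.reverse Γ.finite_range_leftContext_reverse fun p hp => ?_⟩
    obtain ⟨w, hw, hwp⟩ := hper p hp
    exact ⟨w.reverse, by rwa [Set.mem_ofPred_eq, List.reverse_reverse], fun h => hwp (by simpa using h.reverse)⟩
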